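/- **Model.** In a regional bandit machine there are $M$ groups of arms; group $m$ has $K_m\ge 1$ arms $[m,1],\dots,[m,K_m]$ and an unknown parameter $\theta_m\in\Theta_m\subseteq[0,1]$. Each pull of arm $[m,k]$ yields a reward drawn, independently of the past, from a distribution $\nu_{m,k}(\theta_m)$ with expectation $\mu_{m,k}(\theta_m)$, where $\mu_{m,k}$ is an invertible function on $\Theta_m$. Put $\Theta=\prod_m\Theta_m$. A policy chooses (possibly at random) the arm $[m(t),k(t)]$ of each time slot $t$ on the basis of the arms and rewards of the earlier slots, and its regret after $T$ slots is $$R(\boldsymbol\theta,T)=T\max_{m,k}\mu_{m,k}(\theta_m)-\sum_{t=1}^{T}\mathbb E_{\boldsymbol\theta}\big[\mu_{m(t),k(t)}(\theta_{m(t)})\big].$$ The machine is called regular with constants $D_{1,m,k},D_{2,m,k}>0$, $\gamma_{1,m,k}>1$, $0<\gamma_{2,m,k}\le 1$ if for all $m,k$ and all $\theta,\theta'\in\Theta_m$ $$D_{1,m,k}|\theta-\theta'|^{\gamma_{1,m,k}}\le|\mu_{m,k}(\theta)-\mu_{m,k}(\theta')|\le D_{2,m,k}|\theta-\theta'|^{\gamma_{2,m,k}}.$$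 Put $\xi_m=\dfrac{\min_k\gamma_{2,m,k}}{2\max_k\gamma_{1,m,k}}$ and $\xi=\max_m\xi_m$. **Theorem.** For all $b,d>0$ there is a constant $c>0$, depending only on $b$ and $d$, such that the following holds. Let $M\ge 1$ and $K_1,\dots,K_M\ge 1$ with $\sum_m K_m\ge 2$, and let $D_{1,m,k}>0$, $D_{2,m,k}\ge d$, $\gamma_{1,m,k}>1$, $0<\gamma_{2,m,k}\le1$ be constants with $D_{1,m,k}\le\min\{D_{2,m,k},b\}$. Then there is a regional bandit machine with $M$ groups of sizes $K_1,\dots,K_M$, with $\Theta_m=[0,1]$ for all $m$, regular with these constants, with all rewards in $[0,b]$, and in which every arm has the largest expected reward of its group for at least one parameter value (ties allowed), such that for every horizon $T\ge 0$ and every policy (which may depend on the machine and on $T$) $$\sup_{\boldsymbol\theta\in\Theta}R(\boldsymbol\theta,T)\ \ge\ c\,\min\big\{\sqrt{MT},\,T^{1-\xi}\big\}.$$ -/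

import Mathlib

open MeasureTheory ProbabilityTheory

namespace RegionalBandits

/-- The arms `[m, k]` of a bandit with `M` groups, the `m`-th one having `K m` arms. -/
abbrev Arm {M : ℕ} (K : Fin M → ℕ) : Type := Σ m : Fin M, Fin (K m)

instance Arm.instDiscrete {M : ℕ} (K : Fin M → ℕ) : DiscreteMeasurableSpace (Arm K) where
  forall_measurableSet s := by
    rw [MeasurableSpace.measurableSet_iInf]
    intro m
    exact (DiscreteMeasurableSpace.forall_measurableSet (Sigma.mk m ⁻¹' s) :)

/-- A regional bandit machine with `M` groups of sizes `K 1, …, K M`. Group `m` has a set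
`paramSet m ⊆ [0, 1]` of possible parameters, and the arm `a = [m, k]` has a reward distribution
`rewardLaw a θ` that depends only on the parameter `θ` of its own group and has expectation
`mean a θ`; the function `mean a` is invertible on `paramSet m`. (Values at `θ ∉ paramSet m`
are irrelevant.) -/
structure RegionalBandit {M : ℕ} (K : Fin M → ℕ) where
  paramSet : Fin M → Set ℝ
  paramSet_subset : ∀ m, paramSet m ⊆ Set.Icc 0 1
  mean : Arm K → ℝ → ℝ
  mean_injOn : ∀ a : Arm K, Set.InjOn (mean a) (paramSet a.1)
  rewardLaw : Arm K → ℝ → ProbabilityMeasure ℝ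
  integrable_reward : ∀ (a : Arm K), ∀ θ ∈ paramSet a.1,
    Integrable (fun x : ℝ => x) (rewardLaw a θ : Measure ℝ)
  integral_reward : ∀ (a : Arm K), ∀ θ ∈ paramSet a.1,
    ∫ x : ℝ, x ∂(rewardLaw a θ : Measure ℝ) = mean a θ

/-- Histories of length `n`: the arms played and rewards observed in the first `n` time slots. -/
def History (A : Type) : ℕ → Type
  | 0 => Unit
  | n + 1 => History A n × (A × ℝ)

/-- The product σ-algebra on histories. -/
instance History.instMeasurableSpace (A : Type) [MeasurableSpace A] :
    (n : ℕ) → MeasurableSpace (History A n)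
  | 0 => inferInstanceAs (MeasurableSpace Unit)
  | n + 1 =>
    letI : MeasurableSpace (History A n) := History.instMeasurableSpace A n
    inferInstanceAs (MeasurableSpace (History A n × (A × ℝ)))

/-- A (possibly randomized) policy: in time slot `n + 1` the arm is drawn from a distribution that
depends measurably on the history of the first `n` slots. -/
structure Policy (A : Type) [MeasurableSpace A] where
  select : (n : ℕ) → Kernel (History A n) A
  isMarkov : ∀ n, IsMarkovKernel (select n)

instance Policy.instIsMarkovKernel {A : Type} [MeasurableSpace A] (π : Policy A) (n : ℕ) :
    IsMarkovKernel (π.select n) := π.isMarkov n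

noncomputable section

namespace RegionalBandit

variable {M : ℕ} {K : Fin M → ℕ}

/-- The set `Θ = ∏ₘ Θₘ` of parameter vectors. -/
def params (B : RegionalBandit K) : Set (Fin M → ℝ) := {θ | ∀ m, θ m ∈ B.paramSet m}

/-- The rewards of all arms take values in `[0, b]`. -/
def RewardsIn (B : RegionalBandit K) (b : ℝ) : Prop :=
  ∀ a : Arm K, ∀ θ ∈ B.paramSet a.1, ∀ᵐ x ∂(B.rewardLaw a θ : Measure ℝ), x ∈ Set.Icc 0 b

/-- The regularity assumption on the reward functions: the lower bound
`D₁ |θ - θ'| ^ γ₁ ≤ |μ(θ) - μ(θ')|` and the Hölder bound `|μ(θ) - μ(θ')| ≤ D₂ |θ - θ'| ^ γ₂`,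
with constants that may depend on the arm. -/
def Regular (B : RegionalBandit K) (D₁ γ₁ D₂ γ₂ : Arm K → ℝ) : Prop :=
  ∀ a : Arm K, ∀ θ ∈ B.paramSet a.1, ∀ θ' ∈ B.paramSet a.1,
    D₁ a * |θ - θ'| ^ γ₁ a ≤ |B.mean a θ - B.mean a θ'| ∧
    |B.mean a θ - B.mean a θ'| ≤ D₂ a * |θ - θ'| ^ γ₂ a

/-- The optimal region of an arm: the parameters of its group for which it is a best arm of the
group. -/
def optimalRegion (B : RegionalBandit K) (a : Arm K) : Set ℝ :=
  {θ ∈ B.paramSet a.1 | ∀ k : Fin (K a.1), B.mean ⟨a.1, k⟩ θ ≤ B.mean a θ}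

/-- The largest expected reward `μ*(θ)` of an arm under the parameter vector `θ`. -/
def bestMean (B : RegionalBandit K) (θ : Fin M → ℝ) : ℝ := ⨆ a : Arm K, B.mean a (θ a.1)

/-- The distribution of the reward, as a function of the arm played, under `θ`. -/
def rewardKernel (B : RegionalBandit K) (θ : Fin M → ℝ) : Kernel (Arm K) ℝ :=
  Kernel.ofFunOfCountable fun a => (B.rewardLaw a (θ a.1) : Measure ℝ)

instance (B : RegionalBandit K) (θ : Fin M → ℝ) : IsMarkovKernel (B.rewardKernel θ) where
  isProbabilityMeasure a := inferInstanceAs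
    (IsProbabilityMeasure (B.rewardLaw a (θ a.1) : Measure ℝ))

/-- The law of the arm and the reward of time slot `n + 1`, given the history of the first `n`
slots. -/
def stepKernel (B : RegionalBandit K) (θ : Fin M → ℝ) (π : Policy (Arm K)) (n : ℕ) :
    Kernel (History (Arm K) n) (Arm K × ℝ) :=
  π.select n ⊗ₖ Kernel.prodMkLeft (History (Arm K) n) (B.rewardKernel θ)

instance (B : RegionalBandit K) (θ : Fin M → ℝ) (π : Policy (Arm K)) (n : ℕ) :
    IsMarkovKernel (B.stepKernel θ π n) := by
  unfold stepKernel
  infer_instance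

/-- The law of the history of the first `n` time slots when the policy `π` is run under `θ`. -/
def historyLaw (B : RegionalBandit K) (θ : Fin M → ℝ) (π : Policy (Arm K)) :
    (n : ℕ) → Measure (History (Arm K) n)
  | 0 => Measure.dirac ()
  | n + 1 => (B.historyLaw θ π n) ⊗ₘ (B.stepKernel θ π n)

/-- The expectation of `μ_{m(t), k(t)}(θ_{m(t)})` for the arm `[m(t), k(t)]` played in time slot
`t = n + 1`. -/
def expectedMean (B : RegionalBandit K) (θ : Fin M → ℝ) (π : Policy (Arm K)) (n : ℕ) : ℝ :=
  ∫ h : History (Arm K) n × (Arm K × ℝ), B.mean h.2.1 (θ h.2.1.1) ∂(B.historyLaw θ π (n + 1))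

/-- The regret `R(θ, T)` of the policy `π`. -/
def regret (B : RegionalBandit K) (π : Policy (Arm K)) (θ : Fin M → ℝ) (T : ℕ) : ℝ :=
  T * B.bestMean θ - ∑ n ∈ Finset.range T, B.expectedMean θ π n

/-- The worst-case regret `sup_{θ ∈ Θ} R(θ, T)` of the policy `π`. -/
def worstCaseRegret (B : RegionalBandit K) (π : Policy (Arm K)) (T : ℕ) : EReal :=
  ⨆ θ ∈ B.params, (B.regret π θ T : EReal)

end RegionalBandit

/-- The exponent `ξₘ = γ₂ₘ / (2 γ₁ₘ)` of group `m`, where `γ₁ₘ` is the maximum and `γ₂ₘ` the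
minimum of the exponents of the arms of the group. -/
def groupExponent {M : ℕ} {K : Fin M → ℕ} (γ₁ γ₂ : Arm K → ℝ) (m : Fin M) : ℝ :=
  (1 / ⨆ k : Fin (K m), γ₁ ⟨m, k⟩) * (⨅ k : Fin (K m), γ₂ ⟨m, k⟩) / 2

/-- The exponent `ξ = maxₘ ξₘ`. -/
def exponent {M : ℕ} {K : Fin M → ℕ} (γ₁ γ₂ : Arm K → ℝ) : ℝ :=
  ⨆ m : Fin M, groupExponent γ₁ γ₂ m

end

end RegionalBandits

/-!
The hard machine is linear and does not depend on the horizon: the arm `a` has rewards in `{0, b}`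
and mean `b / 2 + s a (θ - 1 / 2)` with `|s a| = min b (D₂ a)`. Since `|θ - θ'| ≤ 1`, a linear
function with `D₁ a ≤ |s a| ≤ D₂ a` satisfies the regularity condition for all exponents
(`linear_regular`). At `θ = 1 / 2` all arms tie, so every arm is optimal there.

The regret bound is the minimax argument for stochastic bandits. Compare the parameter vector
`centre M`, all of whose coordinates are `1 / 2`, with a vector that moves some coordinates by a
small `δ`. The law of the history under the second vector has a density with respect to the first,
the product of the likelihood ratios of the rewards (`integral_likelihood_mul`), and the relative
entropy of the two laws is at most `4 δ ^ 2` times the expected number of plays of the arms whose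
reward law changes (`integral_log_likelihood_ge`). While it is at most `1 / 64`, probabilities
change by at most `1 / 4` (`playProb_le_add`). Hence, if the arms that the move makes optimal
are played at most half of the time under `centre M`, they are still missed a quarter of the time
after the move (`regret_ge_of_playProb_centre`).

For `M ≥ 2` all slopes are positive, and the move raises the parameter of a group that is played
at most its share `T / M` of the time. For `M = 1` one arm is increasing and the others are
decreasing, and the move goes to the side whose optimal arms are played at most half of the time.
The largest `δ` allowed by the relative entropy is of order `min 1 √(M / T)`, and the regret is of
order `δ T`, that is `min √(M T) T`. As the exponent `ξ` is nonnegative, this dominates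
`min √(M T) (T ^ (1 - ξ))`.
-/

namespace RegionalBandits

/-! ### Two-point reward laws and the linear machine -/

/-- The law on `{0, b}` that gives mass `p` to `b`. -/
noncomputable def twoPointLaw (b : ℝ) (p : unitInterval) : ProbabilityMeasure ℝ :=
  ⟨ENNReal.ofReal p • Measure.dirac b + ENNReal.ofReal (1 - p) • Measure.dirac 0, ⟨by
    simp [← ENNReal.ofReal_add p.2.1 (sub_nonneg.2 p.2.2)]⟩⟩

lemma integrable_twoPointLaw (b : ℝ) (p : unitInterval) (f : ℝ → ℝ) :
    Integrable f (twoPointLaw b p : Measure ℝ) :=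
  ((integrable_dirac (by simp)).smul_measure ENNReal.ofReal_ne_top).add_measure
    ((integrable_dirac (by simp)).smul_measure ENNReal.ofReal_ne_top)

lemma integral_twoPointLaw (b : ℝ) (p : unitInterval) (f : ℝ → ℝ) :
    ∫ x, f x ∂(twoPointLaw b p : Measure ℝ) = p * f b + (1 - p) * f 0 := by
  change ∫ x, f x ∂(ENNReal.ofReal p • Measure.dirac b
    + ENNReal.ofReal (1 - p) • Measure.dirac 0) = _
  rw [integral_add_measure ((integrable_dirac (by simp)).smul_measure ENNReal.ofReal_ne_top)
    ((integrable_dirac (by simp)).smul_measure ENNReal.ofReal_ne_top),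
    integral_smul_measure, integral_smul_measure, integral_dirac, integral_dirac,
    ENNReal.toReal_ofReal p.2.1, ENNReal.toReal_ofReal (sub_nonneg.2 p.2.2)]
  simp

lemma ae_twoPointLaw {b : ℝ} (p : unitInterval) {q : ℝ → Prop} (hb : q b) (h0 : q 0) :
    ∀ᵐ x ∂(twoPointLaw b p : Measure ℝ), q x := by
  change ∀ᵐ x ∂(ENNReal.ofReal p • Measure.dirac b
    + ENNReal.ofReal (1 - p) • Measure.dirac 0), q x
  rw [ae_add_measure_iff]
  exact ⟨Measure.ae_smul_measure (by simpa [ae_dirac_eq] using hb) _,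
    Measure.ae_smul_measure (by simpa [ae_dirac_eq] using h0) _⟩

variable {M : ℕ} {K : Fin M → ℕ}

/-- The success probability `1/2 + (s / b) (θ - 1/2)` of an arm of slope `s`, clamped to `[0, 1]`
so that it is defined for every real `θ`. -/
noncomputable def successProb (b s θ : ℝ) : unitInterval :=
  Set.projIcc 0 1 zero_le_one (1 / 2 + s / b * (θ - 1 / 2))

lemma abs_div_mul_le {b s x y : ℝ} (hb : 0 < b) (hs : |s| ≤ b) (hx : |x| ≤ y) :
    |s / b * x| ≤ y := by
  rw [abs_mul, abs_div, abs_of_pos hb]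
  have h : |s| / b ≤ 1 := (div_le_one hb).2 hs
  nlinarith [abs_nonneg x]

lemma coe_successProb {b s θ : ℝ} (hb : 0 < b) (hs : |s| ≤ b) (hθ : θ ∈ Set.Icc (0 : ℝ) 1) :
    (successProb b s θ : ℝ) = 1 / 2 + s / b * (θ - 1 / 2) := by
  have h := abs_le.1 (abs_div_mul_le hb hs
    (show |θ - 1 / 2| ≤ 1 / 2 from abs_le.2 ⟨by linarith [hθ.1], by linarith [hθ.2]⟩))
  rw [successProb, Set.projIcc_of_mem zero_le_one
    (show 1 / 2 + s / b * (θ - 1 / 2) ∈ Set.Icc (0 : ℝ) 1 from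
      ⟨by linarith [h.1], by linarith [h.2]⟩)]

/-- The machine in which the arm `a` has mean `b / 2 + s a (θ - 1 / 2)` on the parameter set
`[0, 1]`, with rewards in `{0, b}`. All arms have the same mean at `θ = 1 / 2`. -/
noncomputable def linearMachine {b : ℝ} (hb : 0 < b) (s : Arm K → ℝ) (hs : ∀ a, s a ≠ 0)
    (hsb : ∀ a, |s a| ≤ b) : RegionalBandit K where
  paramSet _ := Set.Icc 0 1
  paramSet_subset _ := subset_rfl
  mean a θ := b / 2 + s a * (θ - 1 / 2)
  mean_injOn a θ _ θ' _ h := by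
    have := mul_left_cancel₀ (hs a) (add_left_cancel h)
    linarith
  rewardLaw a θ := twoPointLaw b (successProb b (s a) θ)
  integrable_reward a θ _ := integrable_twoPointLaw _ _ _
  integral_reward a θ hθ := by
    rw [integral_twoPointLaw, coe_successProb hb (hsb a) hθ]
    field_simp
    ring

/-! ### Integration against the law of the history -/

section Integration

variable (B : RegionalBandit K) (θ : Fin M → ℝ) (π : Policy (Arm K)) (n : ℕ)

instance RegionalBandit.instIsProbabilityMeasureHistoryLaw :
    IsProbabilityMeasure (B.historyLaw θ π n) := by
  induction n with
  | zero => exact inferInstanceAs (IsProbabilityMeasure (Measure.dirac ()))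
  | succ n ih =>
    exact inferInstanceAs (IsProbabilityMeasure (B.historyLaw θ π n ⊗ₘ B.stepKernel θ π n))

/-- The law of the history of the first `n + 1` time slots, as a measure on the product type to
which `History (Arm K) (n + 1)` unfolds. -/
noncomputable def stepLaw : Measure (History (Arm K) n × (Arm K × ℝ)) :=
  B.historyLaw θ π n ⊗ₘ B.stepKernel θ π n

instance instIsProbabilityMeasureStepLaw : IsProbabilityMeasure (stepLaw B θ π n) := by
  unfold stepLaw
  infer_instance

lemma integrable_of_bounded {α : Type*} [MeasurableSpace α] (μ : Measure α) [IsFiniteMeasure μ]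
    {f : α → ℝ} (hf : Measurable f) {C : ℝ} (hC : ∀ x, |f x| ≤ C) : Integrable f μ :=
  Integrable.of_bound hf.aestronglyMeasurable C (ae_of_all _ hC)

variable {n}

lemma integral_stepKernel (h : History (Arm K) n) {f : Arm K × ℝ → ℝ} (hf : Measurable f)
    {C : ℝ} (hC : ∀ y, |f y| ≤ C) :
    ∫ y, f y ∂(B.stepKernel θ π n h) =
      ∫ a, ∫ x, f (a, x) ∂(B.rewardLaw a (θ a.1) : Measure ℝ) ∂(π.select n h) := by
  rw [RegionalBandit.stepKernel, integral_compProd (integrable_of_bounded _ hf hC)]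
  rfl

lemma integral_stepLaw {f : History (Arm K) n × (Arm K × ℝ) → ℝ} (hf : Measurable f)
    {C : ℝ} (hC : ∀ h, |f h| ≤ C) :
    ∫ h, f h ∂(stepLaw B θ π n) =
      ∫ h, ∫ y, f (h, y) ∂(B.stepKernel θ π n h) ∂(B.historyLaw θ π n) :=
  Measure.integral_compProd (μ := B.historyLaw θ π n) (κ := B.stepKernel θ π n)
    (integrable_of_bounded _ hf hC)

lemma measurable_integral_stepKernel {f : History (Arm K) n × (Arm K × ℝ) → ℝ}
    (hf : Measurable f) : Measurable fun h => ∫ y, f (h, y) ∂(B.stepKernel θ π n h) :=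
  (hf.stronglyMeasurable.integral_kernel_prod_right').measurable

lemma abs_integral_le_of_bounded {α : Type*} [MeasurableSpace α] (μ : Measure α)
    [IsProbabilityMeasure μ] {f : α → ℝ} {C : ℝ} (hC : ∀ x, |f x| ≤ C) :
    |∫ x, f x ∂μ| ≤ C := by
  simpa using norm_integral_le_of_norm_le_const (μ := μ) (f := f) (C := C) (ae_of_all _ hC)

end Integration

/-! ### Likelihood ratios of histories -/

/-- The density at the reward `x` of the two-point law with success probability `1/2 + e` with
respect to the one with success probability `1/2`. -/
noncomputable def rewardRatio (e x : ℝ) : ℝ := if x = 0 then 1 - 2 * e else 1 + 2 * e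

lemma rewardRatio_mem {e : ℝ} (he : |e| ≤ 1 / 4) (x : ℝ) :
    rewardRatio e x ∈ Set.Icc (1 / 2) 2 := by
  have := abs_le.1 he
  unfold rewardRatio
  split_ifs <;> constructor <;> linarith

/-- The likelihood ratio of a history when the reward of each arm `a` has success probability
`1/2 + e a` instead of `1/2`. The policy cancels. -/
noncomputable def likelihood {A : Type} (e : A → ℝ) : (n : ℕ) → History A n → ℝ
  | 0, _ => 1
  | n + 1, (h, a, x) => likelihood e n h * rewardRatio (e a) x

lemma likelihood_mem {A : Type} {e : A → ℝ} (he : ∀ a, |e a| ≤ 1 / 4) :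
    ∀ (n : ℕ) (h : History A n), likelihood e n h ∈ Set.Icc ((1 / 2) ^ n) (2 ^ n)
  | 0, _ => by simp [likelihood]
  | n + 1, (h, a, x) => by
    have h1 := likelihood_mem he n h
    have h2 := rewardRatio_mem (he a) x
    have h3 : (0 : ℝ) < (1 / 2) ^ n := by positivity
    rw [likelihood, pow_succ, pow_succ]
    exact ⟨mul_le_mul h1.1 h2.1 (by norm_num) (h3.le.trans h1.1),
      mul_le_mul h1.2 h2.2 (by linarith [h2.1]) (by positivity)⟩

lemma measurable_rewardRatio {e : Arm K → ℝ} :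
    Measurable fun y : Arm K × ℝ => rewardRatio (e y.1) y.2 := by
  have h : Measurable fun y : Arm K × ℝ => e y.1 := (Measurable.of_discrete (f := e)).comp
    measurable_fst
  exact Measurable.ite (measurable_snd (measurableSet_singleton 0)) (by fun_prop) (by fun_prop)

lemma measurable_likelihood (e : Arm K → ℝ) (n : ℕ) : Measurable (likelihood e n) := by
  induction n with
  | zero => exact measurable_const
  | succ n ih =>
    exact (ih.comp measurable_fst).mul (measurable_rewardRatio.comp measurable_snd)

lemma rewardRatio_integral {b : ℝ} (hb : b ≠ 0) {p q : unitInterval} {e : ℝ}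
    (hp : (p : ℝ) = 1 / 2) (hq : (q : ℝ) = 1 / 2 + e) (f : ℝ → ℝ) :
    ∫ x, rewardRatio e x * f x ∂(twoPointLaw b p : Measure ℝ) =
      ∫ x, f x ∂(twoPointLaw b q : Measure ℝ) := by
  rw [integral_twoPointLaw, integral_twoPointLaw, hp, hq]
  simp only [rewardRatio, hb, if_true, if_false]
  ring

lemma integral_log_rewardRatio_ge {b : ℝ} (hb : b ≠ 0) {p : unitInterval} {e : ℝ}
    (hp : (p : ℝ) = 1 / 2) (he : |e| ≤ 1 / 4) :
    -(4 * e ^ 2) ≤ ∫ x, Real.log (rewardRatio e x) ∂(twoPointLaw b p : Measure ℝ) := by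
  have := abs_le.1 he
  have he2 : e ^ 2 ≤ 1 / 16 := by nlinarith
  rw [integral_twoPointLaw, hp]
  simp only [rewardRatio, hb, if_true, if_false]
  have h1 : Real.log (1 + 2 * e) + Real.log (1 - 2 * e) = Real.log (1 - 4 * e ^ 2) := by
    rw [← Real.log_mul (by linarith) (by linarith)]
    ring_nf
  have hpos : 0 < 1 - 4 * e ^ 2 := by linarith
  have h2 := Real.one_sub_inv_le_log_of_pos hpos
  have h3 : (1 - 4 * e ^ 2)⁻¹ ≤ 1 + 8 * e ^ 2 := by
    rw [inv_le_iff_one_le_mul₀ hpos]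
    nlinarith [sq_nonneg e]
  linarith

/-! ### Change of measure -/

/-- The change of the success probability of each arm of the linear machine when the parameters
change from `1 / 2` to `θ`. -/
noncomputable def tilt (b : ℝ) (s : Arm K → ℝ) (θ : Fin M → ℝ) (a : Arm K) : ℝ :=
  s a / b * (θ a.1 - 1 / 2)

/-- The parameter vector at which all arms of the linear machine are equally good. -/
noncomputable def centre (M : ℕ) : Fin M → ℝ := fun _ => 1 / 2

/-- The probability that the arm played in time slot `n + 1` belongs to `S`. -/
noncomputable def playProb (B : RegionalBandit K) (θ : Fin M → ℝ) (π : Policy (Arm K)) (n : ℕ)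
    (S : Set (Arm K)) : ℝ :=
  ∫ h, S.indicator (fun _ => (1 : ℝ)) h.2.1 ∂(stepLaw B θ π n)

lemma integrable_comp_arm (B : RegionalBandit K) (θ : Fin M → ℝ) (π : Policy (Arm K)) (n : ℕ)
    (g : Arm K → ℝ) : Integrable (fun h : History (Arm K) n × (Arm K × ℝ) => g h.2.1)
      (stepLaw B θ π n) := by
  obtain ⟨C, hC⟩ := (Set.finite_range fun a => |g a|).bddAbove
  exact integrable_of_bounded _
    ((Measurable.of_discrete (f := g)).comp (measurable_fst.comp measurable_snd))
    (C := C) fun h => hC ⟨h.2.1, rfl⟩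

lemma playProb_nonneg (B : RegionalBandit K) (θ : Fin M → ℝ) (π : Policy (Arm K)) (n : ℕ)
    (S : Set (Arm K)) : 0 ≤ playProb B θ π n S :=
  integral_nonneg fun _ => Set.indicator_nonneg (fun _ _ => zero_le_one) _

/-- The probabilities of the classes of a finite partition of the arms add up to one. -/
lemma sum_playProb_fiber (B : RegionalBandit K) (θ : Fin M → ℝ) (π : Policy (Arm K)) (n : ℕ)
    {ι : Type*} [Fintype ι] (c : Arm K → ι) : ∑ i, playProb B θ π n {a | c a = i} = 1 := by
  classical
  unfold playProb
  rw [← integral_finsetSum _ fun i _ =>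
    integrable_comp_arm B θ π n ({a | c a = i}.indicator fun _ => (1 : ℝ))]
  simp [Set.indicator_apply]

section LinearMachine

variable {b : ℝ} (hb : 0 < b) {s : Arm K → ℝ} (hs : ∀ a, s a ≠ 0) (hsb : ∀ a, |s a| ≤ b)
  (π : Policy (Arm K))

include hb hsb in
lemma abs_tilt_le {θ : Fin M → ℝ} {δ : ℝ} (hθ : ∀ m, |θ m - 1 / 2| ≤ δ) (a : Arm K) :
    |tilt b s θ a| ≤ δ := abs_div_mul_le hb (hsb a) (hθ a.1)

lemma coe_successProb_centre (a : Arm K) :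
    (successProb b (s a) (centre M a.1) : ℝ) = 1 / 2 := by
  simp only [successProb, centre, sub_self, mul_zero, add_zero]
  rw [Set.projIcc_of_mem zero_le_one (show (1 / 2 : ℝ) ∈ Set.Icc (0 : ℝ) 1 by norm_num)]

/-- The likelihood is the density of the law of the history under `θ` with respect to the law
under `centre M`. -/
lemma integral_likelihood_mul {θ : Fin M → ℝ} (hθ : ∀ m, |θ m - 1 / 2| ≤ 1 / 4) :
    ∀ (n : ℕ) {f : History (Arm K) n → ℝ}, Measurable f → ∀ {C : ℝ}, (∀ h, |f h| ≤ C) →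
      ∫ h, likelihood (tilt b s θ) n h * f h ∂((linearMachine hb s hs hsb).historyLaw
        (centre M) π n) = ∫ h, f h ∂((linearMachine hb s hs hsb).historyLaw θ π n)
  | 0, f, _, C, _ => by simp [likelihood, RegionalBandit.historyLaw]
  | n + 1, f', hf', C, hC' => by
    have he := abs_tilt_le hb hsb hθ
    suffices key : ∀ f : History (Arm K) n × (Arm K × ℝ) → ℝ, Measurable f → (∀ h, |f h| ≤ C) →
        ∫ h, likelihood (tilt b s θ) n h.1 * rewardRatio (tilt b s θ h.2.1) h.2.2 * f h
          ∂(stepLaw (linearMachine hb s hs hsb) (centre M) π n) =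
        ∫ h, f h ∂(stepLaw (linearMachine hb s hs hsb) θ π n) from key f' hf' hC'
    intro f hf hC
    have hL : Measurable fun h : History (Arm K) n × (Arm K × ℝ) =>
      likelihood (tilt b s θ) n h.1 * rewardRatio (tilt b s θ h.2.1) h.2.2 :=
      measurable_likelihood (tilt b s θ) (n + 1)
    have hLC : ∀ h : History (Arm K) n × (Arm K × ℝ),
        |likelihood (tilt b s θ) n h.1 * rewardRatio (tilt b s θ h.2.1) h.2.2 * f h|
          ≤ 2 ^ (n + 1) * C := fun h => by
      have h1 : likelihood (tilt b s θ) n h.1 * rewardRatio (tilt b s θ h.2.1) h.2.2 ∈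
        Set.Icc ((1 / 2 : ℝ) ^ (n + 1)) (2 ^ (n + 1)) := likelihood_mem he (n + 1) h
      have h2 : (0 : ℝ) < (1 / 2) ^ (n + 1) := by positivity
      rw [abs_mul, abs_of_nonneg (h2.le.trans h1.1)]
      exact mul_le_mul h1.2 (hC h) (abs_nonneg _) (by positivity)
    refine (integral_stepLaw _ _ π (hL.mul hf) hLC).trans ?_
    refine Eq.trans ?_ (integral_stepLaw _ _ π hf hC).symm
    rw [← integral_likelihood_mul hθ n (measurable_integral_stepKernel _ _ π hf) (C := C)
      fun h => abs_integral_le_of_bounded _ fun y => hC (h, y)]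
    refine integral_congr_ae (ae_of_all _ fun h => ?_)
    dsimp only [Pi.mul_apply]
    simp only [mul_assoc]
    rw [integral_const_mul]
    congr 1
    have hfh : Measurable fun y => f (h, y) := hf.comp measurable_prodMk_left
    rw [integral_stepKernel _ _ _ _ hfh fun y => hC (h, y),
      integral_stepKernel _ _ _ _ (f := fun y => rewardRatio (tilt b s θ y.1) y.2 * f (h, y))
        (measurable_rewardRatio.mul hfh) (C := 2 * C) fun y => ?_]
    · refine integral_congr_ae (ae_of_all _ fun a => ?_)
      have h1 := abs_le.1 (hθ a.1)
      have hq : (successProb b (s a) (θ a.1) : ℝ) = 1 / 2 + tilt b s θ a :=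
        coe_successProb hb (hsb a) ⟨by linarith [h1.1], by linarith [h1.2]⟩
      change ∫ x, rewardRatio (tilt b s θ a) x * f (h, (a, x))
          ∂(twoPointLaw b (successProb b (s a) (centre M a.1)) : Measure ℝ) =
        ∫ x, f (h, (a, x)) ∂(twoPointLaw b (successProb b (s a) (θ a.1)) : Measure ℝ)
      exact rewardRatio_integral hb.ne' (coe_successProb_centre a) hq fun x => f (h, (a, x))
    · have h1 := rewardRatio_mem (he y.1) y.2
      rw [abs_mul, abs_of_nonneg (by linarith [h1.1])]
      exact mul_le_mul h1.2 (hC (h, y)) (abs_nonneg _) (by norm_num)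

/-- The relative entropy of the law of the history under `centre M` with respect to its law under
`θ` is at most `4 δ ^ 2` for each expected play of an arm whose parameter differs. -/
lemma integral_log_likelihood_ge {θ : Fin M → ℝ} {δ : ℝ} (hδ : δ ≤ 1 / 4)
    (hθ : ∀ m, |θ m - 1 / 2| ≤ δ) {D : Set (Arm K)} (hD : ∀ a ∉ D, θ a.1 = 1 / 2) (n : ℕ) :
    -(4 * δ ^ 2 * ∑ i ∈ Finset.range n,
        playProb (linearMachine hb s hs hsb) (centre M) π i D) ≤
      ∫ h, Real.log (likelihood (tilt b s θ) n h)
        ∂((linearMachine hb s hs hsb).historyLaw (centre M) π n) := by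
  have heδ := abs_tilt_le hb hsb hθ
  have he : ∀ a, |tilt b s θ a| ≤ 1 / 4 := fun a => (heδ a).trans hδ
  induction n with
  | zero => simp [likelihood]
  | succ n ih =>
    set B := linearMachine hb s hs hsb
    set L := likelihood (tilt b s θ) n
    have habs : ∀ {x c : ℝ}, 0 < c → x ∈ Set.Icc c⁻¹ c → |Real.log x| ≤ Real.log c := by
      intro x c hc hx
      have h0 : 0 < x := (inv_pos.2 hc).trans_le hx.1
      rw [abs_le, ← Real.log_inv]
      exact ⟨Real.log_le_log (inv_pos.2 hc) hx.1, Real.log_le_log h0 hx.2⟩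
    have hLb : ∀ h, |Real.log (L h)| ≤ Real.log (2 ^ n) := fun h =>
      habs (by positivity) (by simpa using likelihood_mem he n h)
    have hrb : ∀ y : Arm K × ℝ, |Real.log (rewardRatio (tilt b s θ y.1) y.2)| ≤ Real.log 2 :=
      fun y => habs two_pos (by simpa using rewardRatio_mem (he y.1) y.2)
    have hLm : Measurable fun h => Real.log (L h) := (measurable_likelihood _ n).log
    have hrm : Measurable fun y : Arm K × ℝ => Real.log (rewardRatio (tilt b s θ y.1) y.2) :=
      measurable_rewardRatio.log
    have hind : Measurable fun y : Arm K × ℝ => 4 * δ ^ 2 * D.indicator (fun _ => (1 : ℝ)) y.1 :=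
      (Measurable.of_discrete (f := fun a => 4 * δ ^ 2 * D.indicator (fun _ => (1 : ℝ)) a)).comp
        measurable_fst
    have hib : ∀ y : Arm K × ℝ, |4 * δ ^ 2 * D.indicator (fun _ => (1 : ℝ)) y.1| ≤ 4 * δ ^ 2 := by
      intro y
      by_cases hy : y.1 ∈ D <;> simp [hy, sq_nonneg]
    have hLi : Integrable (fun h => Real.log (L h.1)) (stepLaw B (centre M) π n) :=
      integrable_of_bounded _ (hLm.comp measurable_fst) fun h => hLb h.1
    have hri : Integrable (fun h => Real.log (rewardRatio (tilt b s θ h.2.1) h.2.2))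
        (stepLaw B (centre M) π n) :=
      integrable_of_bounded _ (hrm.comp measurable_snd) fun h => hrb h.2
    have hii : Integrable (fun h => 4 * δ ^ 2 * D.indicator (fun _ => (1 : ℝ)) h.2.1)
        (stepLaw B (centre M) π n) :=
      integrable_of_bounded _ (hind.comp measurable_snd) fun h => hib h.2
    have hsplit : ∫ h, Real.log (likelihood (tilt b s θ) (n + 1) h)
        ∂(B.historyLaw (centre M) π (n + 1)) =
        ∫ h, Real.log (L h.1) ∂(stepLaw B (centre M) π n) +
        ∫ h, Real.log (rewardRatio (tilt b s θ h.2.1) h.2.2) ∂(stepLaw B (centre M) π n) := by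
      rw [← integral_add hLi hri]
      change ∫ h, Real.log (L h.1 * rewardRatio (tilt b s θ h.2.1) h.2.2)
        ∂(stepLaw B (centre M) π n) = _
      refine integral_congr_ae (ae_of_all _ fun ⟨h, a, x⟩ => ?_)
      refine Real.log_mul ?_ ?_
      · have h1 : (0 : ℝ) < (1 / 2) ^ n := by positivity
        exact (h1.trans_le (likelihood_mem he n h).1).ne'
      · have h1 := (rewardRatio_mem (he a) x).1
        linarith
    have hfst : ∫ h, Real.log (L h.1) ∂(stepLaw B (centre M) π n) =
        ∫ h, Real.log (L h) ∂(B.historyLaw (centre M) π n) := by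
      rw [integral_stepLaw _ _ π (f := fun h => Real.log (L h.1))
        (hLm.comp measurable_fst) fun h => hLb h.1]
      simp
    have hsnd : 0 ≤ ∫ h, (Real.log (rewardRatio (tilt b s θ h.2.1) h.2.2)
          + 4 * δ ^ 2 * D.indicator (fun _ => (1 : ℝ)) h.2.1)
        ∂(stepLaw B (centre M) π n) := by
      rw [integral_stepLaw _ _ π
        (f := fun h => Real.log (rewardRatio (tilt b s θ h.2.1) h.2.2)
          + 4 * δ ^ 2 * D.indicator (fun _ => (1 : ℝ)) h.2.1)
        ((hrm.add hind).comp measurable_snd)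
        fun h => (abs_add_le _ _).trans (add_le_add (hrb h.2) (hib h.2))]
      refine integral_nonneg fun h => ?_
      dsimp only
      rw [integral_stepKernel _ _ _ _
        (f := fun y => Real.log (rewardRatio (tilt b s θ y.1) y.2)
          + 4 * δ ^ 2 * D.indicator (fun _ => (1 : ℝ)) y.1) (hrm.add hind)
        fun y => (abs_add_le _ _).trans (add_le_add (hrb y) (hib y))]
      refine integral_nonneg fun a => ?_
      change 0 ≤ ∫ x, (Real.log (rewardRatio (tilt b s θ a) x)
        + 4 * δ ^ 2 * D.indicator (fun _ => (1 : ℝ)) a)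
          ∂(twoPointLaw b (successProb b (s a) (centre M a.1)) : Measure ℝ)
      have h1 : -(4 * tilt b s θ a ^ 2) ≤ ∫ x, Real.log (rewardRatio (tilt b s θ a) x)
          ∂(twoPointLaw b (successProb b (s a) (centre M a.1)) : Measure ℝ) :=
        integral_log_rewardRatio_ge hb.ne' (coe_successProb_centre a) (he a)
      rw [integral_add (integrable_twoPointLaw _ _ _) (integrable_const _), integral_const]
      simp only [probReal_univ, one_smul]
      by_cases ha : a ∈ D
      · have h2 := sq_le_sq' (neg_le_of_abs_le (heδ a)) (le_of_abs_le (heδ a))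
        simp only [ha, Set.indicator_of_mem]
        linarith
      · have h2 : tilt b s θ a = 0 := by simp [tilt, hD a ha]
        rw [h2] at h1 ⊢
        simp only [ha, not_false_eq_true, Set.indicator_of_notMem]
        linarith
    rw [integral_add hri hii, integral_const_mul] at hsnd
    rw [hsplit, hfst, Finset.sum_range_succ, mul_add]
    change 0 ≤ _ + 4 * δ ^ 2 * playProb B (centre M) π n D at hsnd
    linarith

/-- A pointwise form of Pinsker's inequality. For a likelihood ratio `x`, of mean one, the right
side has mean `1 / 8` plus eight times the relative entropy. -/
lemma sub_one_le_log_bound {x : ℝ} (hx : 0 < x) :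
    max 0 (x - 1) ≤ (x + 1) / 16 + 8 * (x - 1 - Real.log x) := by
  -- With `y = √x`, `log x ≤ 2 (y - 1)` bounds the right side from below by
  -- `(y ^ 2 + 1) / 16 + 8 (y - 1) ^ 2 ≥ (y + 1) ^ 2 / 32 + 8 (y - 1) ^ 2 ≥ (y + 1) (y - 1)`.
  have hy := Real.sqrt_pos.2 hx
  have hsq := Real.sq_sqrt hx.le
  have hlog : Real.log x ≤ 2 * (√x - 1) := by
    have := Real.log_le_sub_one_of_pos hy
    rw [Real.log_sqrt hx.le] at this
    linarith
  have := Real.log_le_sub_one_of_pos hx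
  refine max_le (by linarith) ?_
  nlinarith [sq_nonneg (√x + 1 - 16 * (√x - 1)), sq_nonneg (√x - 1)]

/-- When the relative entropy of the histories is small, a change of the parameters changes
probabilities by at most `1 / 4`. -/
lemma playProb_le_add {θ : Fin M → ℝ} {δ : ℝ} (hδ : δ ≤ 1 / 4)
    (hθ : ∀ m, |θ m - 1 / 2| ≤ δ) {D : Set (Arm K)} (hD : ∀ a ∉ D, θ a.1 = 1 / 2) {n : ℕ}
    (hn : 4 * δ ^ 2 * ∑ i ∈ Finset.range (n + 1),
      playProb (linearMachine hb s hs hsb) (centre M) π i D ≤ 1 / 64) (S : Set (Arm K)) :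
    playProb (linearMachine hb s hs hsb) θ π n S ≤
      playProb (linearMachine hb s hs hsb) (centre M) π n S + 1 / 4 := by
  have hθ' : ∀ m, |θ m - 1 / 2| ≤ 1 / 4 := fun m => (hθ m).trans hδ
  have he := abs_tilt_le hb hsb hθ'
  set B := linearMachine hb s hs hsb
  set μ := stepLaw B (centre M) π n
  set L : History (Arm K) n × (Arm K × ℝ) → ℝ := likelihood (tilt b s θ) (n + 1)
  set g : History (Arm K) n × (Arm K × ℝ) → ℝ := fun h => S.indicator (fun _ => (1 : ℝ)) h.2.1
  have hL : ∀ h, L h ∈ Set.Icc ((1 / 2 : ℝ) ^ (n + 1)) (2 ^ (n + 1)) := likelihood_mem he (n + 1)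
  have hhalf : (0 : ℝ) < (1 / 2) ^ (n + 1) := by positivity
  have hpos : ∀ h, 0 < L h := fun h => hhalf.trans_le (hL h).1
  have hLm : Measurable L := measurable_likelihood _ (n + 1)
  have hgm : Measurable g :=
    (Measurable.of_discrete (f := S.indicator fun _ => (1 : ℝ))).comp
      (measurable_fst.comp measurable_snd)
  have hg : ∀ h, g h = 0 ∨ g h = 1 := fun h => by
    by_cases hh : h.2.1 ∈ S <;> simp [g, hh]
  have hgb : ∀ h, |g h| ≤ 1 := fun h => by rcases hg h with h | h <;> simp [h]
  have hLi : Integrable L μ := integrable_of_bounded _ hLm (C := 2 ^ (n + 1)) fun h => by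
    rw [abs_of_pos (hpos h)]
    exact (hL h).2
  have hlogi : Integrable (fun h => Real.log (L h)) μ :=
    integrable_of_bounded _ hLm.log (C := Real.log (2 ^ (n + 1))) fun h => by
      rw [abs_le, ← Real.log_inv, ← inv_pow, inv_eq_one_div]
      exact ⟨Real.log_le_log hhalf (hL h).1, Real.log_le_log (hpos h) (hL h).2⟩
  have hgi : Integrable g μ := integrable_of_bounded _ hgm hgb
  have hLg : Integrable (fun h => L h * g h) μ :=
    integrable_of_bounded _ (hLm.mul hgm) (C := 2 ^ (n + 1) * 1) fun h => by
      rw [abs_mul, abs_of_pos (hpos h)]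
      exact mul_le_mul (hL h).2 (hgb h) (abs_nonneg _) (by positivity)
  have hone : ∫ h, L h ∂μ = 1 := by
    have : ∫ h, L h * 1 ∂μ = ∫ h, 1 ∂(stepLaw B θ π n) := integral_likelihood_mul hb hs hsb π hθ' (n + 1) (f := fun _ => 1) measurable_const
      (C := 1) (by simp)
    simpa using this
  have hchange : ∫ h, L h * g h ∂μ = playProb B θ π n S :=
    integral_likelihood_mul hb hs hsb π hθ' (n + 1) hgm hgb
  have hlog := integral_log_likelihood_ge hb hs hsb π hδ hθ hD (n + 1)
  change _ ≤ ∫ h, Real.log (L h) ∂μ at hlog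
  have hmono : ∫ h, L h * g h ∂μ ≤
      ∫ h, (g h + ((L h + 1) / 16 + 8 * (L h - 1 - Real.log (L h)))) ∂μ := by
    refine integral_mono hLg (hgi.add ((((hLi.add (integrable_const 1)).div_const 16)).add
      (((hLi.sub (integrable_const 1)).sub hlogi).const_mul 8))) fun h => ?_
    have hm := max_le_iff.1 (sub_one_le_log_bound (hpos h))
    dsimp only
    rcases hg h with h | h <;> rw [h] <;> linarith [hm.1, hm.2]
  have hint : ∫ h, (g h + ((L h + 1) / 16 + 8 * (L h - 1 - Real.log (L h)))) ∂μ =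
      ∫ h, g h ∂μ + ((1 + 1) / 16 + 8 * (1 - 1 - ∫ h, Real.log (L h) ∂μ)) := by
    have i1 : Integrable (fun h => L h + 1) μ := hLi.add (integrable_const 1)
    have i2 : Integrable (fun h => L h - 1) μ := hLi.sub (integrable_const 1)
    have i3 : Integrable (fun h => L h - 1 - Real.log (L h)) μ := i2.sub hlogi
    have i4 : Integrable (fun h => (L h + 1) / 16 + 8 * (L h - 1 - Real.log (L h))) μ :=
      (i1.div_const 16).add (i3.const_mul 8)
    rw [integral_add hgi i4,
      integral_add (i1.div_const 16) (i3.const_mul 8), integral_div, integral_const_mul,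
      integral_sub i2 hlogi, integral_add hLi (integrable_const 1),
      integral_sub hLi (integrable_const 1), hone]
    simp
  rw [hint, hchange] at hmono
  change _ ≤ playProb B (centre M) π n S + _ at hmono
  linarith

end LinearMachine

/-! ### The regret of the linear machine -/

/-- Each slot in which no arm of `S` is played costs at least `κ`. -/
lemma bestMean_sub_expectedMean_ge (B : RegionalBandit K) (θ : Fin M → ℝ) (π : Policy (Arm K))
    (n : ℕ) {S : Set (Arm K)} {κ : ℝ} (hS : ∀ a ∉ S, B.mean a (θ a.1) + κ ≤ B.bestMean θ) :
    κ * (1 - playProb B θ π n S) ≤ B.bestMean θ - B.expectedMean θ π n := by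
  have hle : ∀ a, B.mean a (θ a.1) ≤ B.bestMean θ :=
    le_ciSup (f := fun a => B.mean a (θ a.1)) (Set.finite_range _).bddAbove
  have hm := integrable_comp_arm B θ π n fun a => B.mean a (θ a.1)
  have hi := integrable_comp_arm B θ π n (S.indicator fun _ => (1 : ℝ))
  have hκ : Integrable (fun h => κ * (1 - S.indicator (fun _ => (1 : ℝ)) h.2.1))
      (stepLaw B θ π n) := ((integrable_const 1).sub hi).const_mul κ
  have h0 : ∫ h, (B.mean h.2.1 (θ h.2.1.1) + κ * (1 - S.indicator (fun _ => (1 : ℝ)) h.2.1))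
      ∂(stepLaw B θ π n) ≤ ∫ _, B.bestMean θ ∂(stepLaw B θ π n) := by
    refine integral_mono (hm.add hκ) (integrable_const _) fun h => ?_
    by_cases hh : h.2.1 ∈ S
    · simpa [hh] using hle h.2.1
    · simpa [hh] using hS _ hh
  rw [integral_add hm hκ, integral_const_mul,
    integral_sub (integrable_const 1) hi] at h0
  simp only [integral_const, probReal_univ, one_smul] at h0
  change B.expectedMean θ π n + κ * (1 - playProb B θ π n S) ≤ _ at h0
  linarith

lemma mul_sum_playProb_le_regret (B : RegionalBandit K) (θ : Fin M → ℝ) (π : Policy (Arm K))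
    (T : ℕ) {S : Set (Arm K)} {κ : ℝ} (hS : ∀ a ∉ S, B.mean a (θ a.1) + κ ≤ B.bestMean θ) :
    κ * (T - ∑ n ∈ Finset.range T, playProb B θ π n S) ≤ B.regret π θ T := by
  have h := Finset.sum_le_sum fun n (_ : n ∈ Finset.range T) =>
    bestMean_sub_expectedMean_ge B θ π n hS
  rw [← Finset.mul_sum, Finset.sum_sub_distrib, Finset.sum_sub_distrib] at h
  simpa [RegionalBandit.regret] using h

section LinearMachine

variable {b : ℝ} (hb : 0 < b) {s : Arm K → ℝ} (hs : ∀ a, s a ≠ 0) (hsb : ∀ a, |s a| ≤ b)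
  (π : Policy (Arm K))

/-- If a policy plays the arms of `S` at most half of the time under `centre M`, and the arms whose
reward law changes under `θ` are not played often enough to detect the change, then it misses the
arms of `S` a quarter of the time under `θ`. -/
lemma regret_ge_of_playProb_centre {θ : Fin M → ℝ} {δ : ℝ} (hδ : δ ≤ 1 / 4)
    (hθ : ∀ m, |θ m - 1 / 2| ≤ δ) {D S : Set (Arm K)} (hD : ∀ a ∉ D, θ a.1 = 1 / 2) {T : ℕ}
    (hDT : 4 * δ ^ 2 * ∑ i ∈ Finset.range T,
      playProb (linearMachine hb s hs hsb) (centre M) π i D ≤ 1 / 64)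
    (hST : ∑ i ∈ Finset.range T,
      playProb (linearMachine hb s hs hsb) (centre M) π i S ≤ T / 2) {κ : ℝ} (hκ : 0 ≤ κ)
    (a₀ : Arm K) (hS : ∀ a ∉ S, s a * (θ a.1 - 1 / 2) + κ ≤ s a₀ * (θ a₀.1 - 1 / 2)) :
    κ * (T / 4) ≤ (linearMachine hb s hs hsb).regret π θ T := by
  have hbest : ∀ a ∉ S, (linearMachine hb s hs hsb).mean a (θ a.1) + κ ≤
      (linearMachine hb s hs hsb).bestMean θ := fun a ha =>
    le_trans (by
      change b / 2 + s a * (θ a.1 - 1 / 2) + κ ≤ b / 2 + s a₀ * (θ a₀.1 - 1 / 2)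
      linarith [hS a ha])
      (le_ciSup (f := fun a => (linearMachine hb s hs hsb).mean a (θ a.1))
        (Set.finite_range _).bddAbove a₀)
  refine le_trans ?_ (mul_sum_playProb_le_regret _ θ π T hbest)
  refine mul_le_mul_of_nonneg_left ?_ hκ
  have h : ∀ n ∈ Finset.range T, playProb (linearMachine hb s hs hsb) θ π n S ≤
      playProb (linearMachine hb s hs hsb) (centre M) π n S + 1 / 4 := fun n hn =>
    playProb_le_add hb hs hsb π hδ hθ hD
      (le_trans (mul_le_mul_of_nonneg_left (Finset.sum_le_sum_of_subset_of_nonneg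
        (Finset.range_subset_range.2 (Finset.mem_range.1 hn))
        fun _ _ _ => playProb_nonneg _ _ _ _ _) (by positivity)) hDT) S
  have h2 := Finset.sum_le_sum h
  rw [Finset.sum_add_distrib] at h2
  simp only [Finset.sum_const, Finset.card_range, nsmul_eq_mul] at h2
  linarith

/-- Some class of a finite partition of the arms is played at most its share of the time. -/
lemma exists_sum_playProb_le (B : RegionalBandit K) (θ : Fin M → ℝ) (T : ℕ)
    {ι : Type*} [Fintype ι] [Nonempty ι] (c : Arm K → ι) :
    ∃ i, ∑ n ∈ Finset.range T, playProb B θ π n {a | c a = i} ≤ T / Fintype.card ι := by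
  obtain ⟨i, -, hi⟩ := Finset.exists_le_of_sum_le (s := Finset.univ)
    (f := fun i => ∑ n ∈ Finset.range T, playProb B θ π n {a | c a = i})
    (g := fun _ => (T : ℝ) / Fintype.card ι) Finset.univ_nonempty (by
      rw [Finset.sum_comm]
      simp only [sum_playProb_fiber]
      simp [mul_div_cancel₀])
  exact ⟨i, hi⟩

lemma sum_playProb_univ (B : RegionalBandit K) (θ : Fin M → ℝ) (T : ℕ) :
    ∑ n ∈ Finset.range T, playProb B θ π n Set.univ = T := by
  simp [playProb]

/-- Several groups: raising the parameter of a group that is played at most its share of the time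
under `centre M` makes it the only good group. -/
lemma exists_regret_ge_of_two_le (hM : 2 ≤ M) {κ : ℝ} (hκ : 0 ≤ κ) (hκs : ∀ a, κ ≤ s a)
    (hK : ∀ m, 1 ≤ K m) {T : ℕ} {δ : ℝ} (hδ0 : 0 ≤ δ) (hδ : δ ≤ 1 / 4)
    (hδT : 4 * δ ^ 2 * (T / M) ≤ 1 / 64) :
    ∃ θ : Fin M → ℝ, (∀ m, |θ m - 1 / 2| ≤ δ) ∧
      κ * δ * (T / 4) ≤ (linearMachine hb s hs hsb).regret π θ T := by
  have : Nonempty (Fin M) := ⟨⟨0, by omega⟩⟩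
  obtain ⟨m, hm⟩ := exists_sum_playProb_le π (linearMachine hb s hs hsb) (centre M) T
    (fun a => a.1)
  rw [Fintype.card_fin] at hm
  have hθ : ∀ m', |Function.update (centre M) m (1 / 2 + δ) m' - 1 / 2| ≤ δ := fun m' => by
    rcases eq_or_ne m' m with rfl | h
    · simp [abs_of_nonneg hδ0]
    · simp [h, centre, hδ0]
  refine ⟨_, hθ, regret_ge_of_playProb_centre hb hs hsb π hδ hθ (D := {a | a.1 = m})
    (S := {a | a.1 = m}) (fun a ha => ?_) (le_trans ?_ hδT) (hm.trans ?_) (by positivity)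
    ⟨m, ⟨0, hK m⟩⟩ fun a ha => ?_⟩
  · simp [Function.update_of_ne (show a.1 ≠ m from ha), centre]
  · gcongr
  · gcongr
    exact_mod_cast hM
  · simp only [Function.update_of_ne (show a.1 ≠ m from ha), centre, Function.update_self]
    have := mul_le_mul_of_nonneg_right (hκs ⟨m, ⟨0, hK m⟩⟩) hδ0
    linarith

/-- One group: an increasing arm and decreasing arms are distinguished only by the sign of
`θ - 1 / 2`, and one of the two sides is played at most half of the time under `centre M`. -/
lemma exists_regret_ge_of_signs {κ : ℝ} (hκ : 0 ≤ κ)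
    (a₁ a₂ : Arm K) (h₁ : κ ≤ s a₁) (h₂ : s a₂ ≤ -κ) (hs₁ : ∀ a ≠ a₁, s a ≤ 0) {T : ℕ} {δ : ℝ}
    (hδ0 : 0 ≤ δ) (hδ : δ ≤ 1 / 4) (hδT : 4 * δ ^ 2 * T ≤ 1 / 64) :
    ∃ θ : Fin M → ℝ, (∀ m, |θ m - 1 / 2| ≤ δ) ∧
      κ * δ * (T / 4) ≤ (linearMachine hb s hs hsb).regret π θ T := by
  classical
  have hD : 4 * δ ^ 2 * ∑ i ∈ Finset.range T,
      playProb (linearMachine hb s hs hsb) (centre M) π i Set.univ ≤ 1 / 64 := by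
    rwa [sum_playProb_univ]
  obtain ⟨i, hi⟩ := exists_sum_playProb_le π (linearMachine hb s hs hsb) (centre M) T
    (fun a => decide (a = a₁))
  rw [Fintype.card_bool] at hi
  cases i with
  | true =>
    have hθ : ∀ m' : Fin M, |(fun _ => 1 / 2 + δ : Fin M → ℝ) m' - 1 / 2| ≤ δ := fun m' => by
      simp [abs_of_nonneg hδ0]
    refine ⟨_, hθ, regret_ge_of_playProb_centre hb hs hsb π hδ hθ (D := Set.univ)
      (fun a ha => absurd (Set.mem_univ a) ha) hD (by exact_mod_cast hi) (by positivity) a₁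
      fun a ha => ?_⟩
    have h := mul_le_mul_of_nonneg_right (hs₁ a (by simpa using ha)) hδ0
    have h' := mul_le_mul_of_nonneg_right h₁ hδ0
    simp only [add_sub_cancel_left]
    linarith
  | false =>
    have hθ : ∀ m' : Fin M, |(fun _ => 1 / 2 - δ : Fin M → ℝ) m' - 1 / 2| ≤ δ := fun m' => by
      simp [abs_of_nonneg hδ0]
    refine ⟨_, hθ, regret_ge_of_playProb_centre hb hs hsb π hδ hθ (D := Set.univ)
      (fun a ha => absurd (Set.mem_univ a) ha) hD (by exact_mod_cast hi) (by positivity) a₂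
      fun a ha => ?_⟩
    obtain rfl : a = a₁ := by simpa using ha
    have h := mul_le_mul_of_nonneg_right h₁ hδ0
    have h' := mul_le_mul_of_nonneg_right h₂ hδ0
    nlinarith [mul_nonneg hκ hδ0]

end LinearMachine

/-! ### The machine for given constants -/

/-- The slopes of the hard machine: as steep as the bound `b` on the rewards and the Hölder
constants allow, and increasing, except that all arms but one decrease when there is only one
group. -/
noncomputable def hardSlope (b : ℝ) (D₂ : Arm K → ℝ) (a : Arm K) : ℝ :=
  if M = 1 ∧ a.2.val ≠ 0 then -min b (D₂ a) else min b (D₂ a)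

lemma abs_hardSlope {b : ℝ} (hb : 0 < b) {D₂ : Arm K → ℝ} {a : Arm K} (ha : 0 < D₂ a) :
    |hardSlope b D₂ a| = min b (D₂ a) := by
  unfold hardSlope
  split_ifs <;> simp [abs_of_pos (lt_min hb ha)]

/-- On `[0, 1]` a linear function is sandwiched between the powers of the regularity condition,
whatever the exponents. -/
lemma linear_regular {D₁ γ₁ D₂ γ₂ s x : ℝ} (h₁ : D₁ ≤ |s|) (h₂ : |s| ≤ D₂)
    (hγ₁ : 1 ≤ γ₁) (hγ₂ : 0 < γ₂) (hγ₂' : γ₂ ≤ 1) (hx : |x| ≤ 1) :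
    D₁ * |x| ^ γ₁ ≤ |s * x| ∧ |s * x| ≤ D₂ * |x| ^ γ₂ := by
  have h3 : |x| ^ γ₁ ≤ |x| := by
    simpa using Real.rpow_le_rpow_of_exponent_ge' (abs_nonneg x) hx zero_le_one hγ₁
  have h4 : |x| ≤ |x| ^ γ₂ := by
    simpa using Real.rpow_le_rpow_of_exponent_ge' (abs_nonneg x) hx hγ₂.le hγ₂'
  rw [abs_mul]
  exact ⟨mul_le_mul h₁ h3 (by positivity) (abs_nonneg s),
    mul_le_mul h₂ h4 (abs_nonneg x) ((abs_nonneg s).trans h₂)⟩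

lemma exponent_nonneg {γ₁ γ₂ : Arm K → ℝ} (h₁ : ∀ a, 0 ≤ γ₁ a) (h₂ : ∀ a, 0 ≤ γ₂ a) :
    0 ≤ exponent γ₁ γ₂ :=
  Real.iSup_nonneg fun _ => div_nonneg (mul_nonneg
    (div_nonneg zero_le_one (Real.iSup_nonneg fun _ => h₁ _))
    (Real.iInf_nonneg fun _ => h₂ _)) zero_le_two

/-- The two regimes of the minimax regret: linear in `T` for `T ≤ M`, of order `√(M T)` beyond. -/
lemma exists_hardMachine_regret_ge {b κ : ℝ} (hb : 0 < b) (hκ : 0 ≤ κ) {D₂ : Arm K → ℝ}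
    (hs : ∀ a, hardSlope b D₂ a ≠ 0) (hsb : ∀ a, |hardSlope b D₂ a| ≤ b)
    (hκs : ∀ a, κ ≤ min b (D₂ a)) (hK : ∀ m, 1 ≤ K m) (hsum : 2 ≤ ∑ m, K m)
    (π : Policy (Arm K)) {T : ℕ} (hT : 1 ≤ T) :
    ∃ θ : Fin M → ℝ, (∀ m, |θ m - 1 / 2| ≤ 1 / 2) ∧
      κ / 64 * min (√(M * T)) T ≤ (linearMachine hb _ hs hsb).regret π θ T := by
  have hM : 1 ≤ M := by
    rcases Nat.eq_zero_or_pos M with rfl | h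
    · simp at hsum
    · exact h
  have hT0 : (0 : ℝ) < T := by exact_mod_cast hT
  have hM0 : (0 : ℝ) < M := by exact_mod_cast hM
  -- The displacement that about `T / M` observations of a group fail to detect.
  set δ : ℝ := min 1 (√(M / T)) / 16
  have hmin0 : 0 ≤ min 1 (√((M : ℝ) / T)) := le_min zero_le_one (Real.sqrt_nonneg _)
  have hδ0 : 0 ≤ δ := by positivity
  have hδ : δ ≤ 1 / 4 := by
    have := min_le_left 1 (√((M : ℝ) / T))
    simp only [δ]
    linarith
  have hδT : 4 * δ ^ 2 * (T / M) ≤ 1 / 64 := by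
    have h1 : min 1 (√((M : ℝ) / T)) ^ 2 ≤ M / T := by
      exact (pow_le_pow_left₀ hmin0 (min_le_right _ _) 2).trans_eq (Real.sq_sqrt (by positivity))
    calc 4 * δ ^ 2 * ((T : ℝ) / M) = min 1 (√((M : ℝ) / T)) ^ 2 * ((T : ℝ) / M) / 64 := by
          simp only [δ]
          ring
      _ ≤ (M : ℝ) / T * (T / M) / 64 := by gcongr
      _ = 1 / 64 := by field_simp
  have hval : κ / 64 * min (√(M * T)) T = κ * δ * (T / 4) := by
    have h1 : √((M : ℝ) / T) * T = √(M * T) := by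
      rw [Real.sqrt_div hM0.le, Real.sqrt_mul hM0.le]
      field_simp
      rw [Real.sq_sqrt hT0.le]
    rw [← h1, min_comm]
    nth_rewrite 1 [← one_mul (T : ℝ)]
    rw [← min_mul_of_nonneg _ _ hT0.le]
    simp only [δ]
    ring
  rw [hval]
  suffices h : ∃ θ : Fin M → ℝ, (∀ m, |θ m - 1 / 2| ≤ δ) ∧
      κ * δ * (T / 4) ≤ (linearMachine hb _ hs hsb).regret π θ T by
    obtain ⟨θ, h1, h2⟩ := h
    exact ⟨θ, fun m => (h1 m).trans (by linarith), h2⟩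
  rcases hM.eq_or_lt with rfl | hM2
  · have hK2 : 2 ≤ K 0 := by simpa using hsum
    refine exists_regret_ge_of_signs hb hs hsb π hκ ⟨0, ⟨0, by omega⟩⟩ ⟨0, ⟨1, by omega⟩⟩
      ?_ ?_ ?_ hδ0 hδ (by simpa using hδT)
    · simpa [hardSlope] using hκs _
    · simpa [hardSlope] using hκs _
    · rintro ⟨m, k⟩ ha
      have hk : k.val ≠ 0 := fun h => ha (by
        obtain rfl := Subsingleton.elim m 0
        congr
        exact Fin.ext h)
      simpa [hardSlope, hk] using hκ.trans (hκs ⟨m, k⟩)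
  · exact exists_regret_ge_of_two_le hb hs hsb π hM2 hκ
      (fun a => by simpa [hardSlope, hM2.ne'] using hκs a) hK hδ0 hδ hδT

end RegionalBandits

theorem theorem3 (b d : ℝ) (hb : 0 < b) (hd : 0 < d) :
    ∃ c : ℝ, 0 < c ∧
      ∀ (M : ℕ) (K : Fin M → ℕ), (∀ m, 1 ≤ K m) → 2 ≤ ∑ m, K m →
      ∀ D₁ γ₁ D₂ γ₂ : RegionalBandits.Arm K → ℝ,
        (∀ a, 0 < D₁ a ∧ D₁ a ≤ D₂ a ∧ D₁ a ≤ b ∧ d ≤ D₂ a ∧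
          1 < γ₁ a ∧ 0 < γ₂ a ∧ γ₂ a ≤ 1) →
      ∃ B : RegionalBandits.RegionalBandit K,
        (∀ m, B.paramSet m = Set.Icc 0 1) ∧
        B.RewardsIn b ∧
        B.Regular D₁ γ₁ D₂ γ₂ ∧
        (∀ a, (B.optimalRegion a).Nonempty) ∧
        ∀ (T : ℕ) (π : RegionalBandits.Policy (RegionalBandits.Arm K)),
          ((c * min (Real.sqrt (M * T))
              ((T : ℝ) ^ (1 - RegionalBandits.exponent γ₁ γ₂)) : ℝ) : EReal)
            ≤ B.worstCaseRegret π T := by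
  have hκ : 0 < min b d := lt_min hb hd
  refine ⟨min b d / 64, by positivity, fun M K hK hsum D₁ γ₁ D₂ γ₂ hc => ?_⟩
  have hD₂ : ∀ a, 0 < D₂ a := fun a => hd.trans_le (hc a).2.2.2.1
  have habs := fun a => RegionalBandits.abs_hardSlope hb (hD₂ a)
  have hs : ∀ a, RegionalBandits.hardSlope b D₂ a ≠ 0 := fun a =>
    abs_pos.1 ((lt_min hb (hD₂ a)).trans_eq (habs a).symm)
  have hsb : ∀ a, |RegionalBandits.hardSlope b D₂ a| ≤ b := fun a =>
    (habs a).trans_le (min_le_left _ _)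
  refine ⟨RegionalBandits.linearMachine hb _ hs hsb, fun _ => rfl, fun a θ _ => ?_,
    fun a θ hθ θ' hθ' => ?_, fun a => ?_, fun T π => ?_⟩
  · exact RegionalBandits.ae_twoPointLaw _ ⟨hb.le, le_rfl⟩ ⟨le_rfl, hb.le⟩
  · obtain ⟨h1, h2, h3, h4, h5, h6, h7⟩ := hc a
    have hx : (b / 2 + RegionalBandits.hardSlope b D₂ a * (θ - 1 / 2))
        - (b / 2 + RegionalBandits.hardSlope b D₂ a * (θ' - 1 / 2)) =
        RegionalBandits.hardSlope b D₂ a * (θ - θ') := by ring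
    change _ ≤ |(b / 2 + RegionalBandits.hardSlope b D₂ a * (θ - 1 / 2))
        - (b / 2 + RegionalBandits.hardSlope b D₂ a * (θ' - 1 / 2))| ∧
      |(b / 2 + RegionalBandits.hardSlope b D₂ a * (θ - 1 / 2))
        - (b / 2 + RegionalBandits.hardSlope b D₂ a * (θ' - 1 / 2))| ≤ _
    rw [hx]
    refine RegionalBandits.linear_regular ?_ ?_ h5.le h6 h7
      (abs_le.2 ⟨by linarith [hθ.1, hθ'.2], by linarith [hθ.2, hθ'.1]⟩)
    · rw [habs]
      exact le_min h3 h2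
    · rw [habs]
      exact min_le_right _ _
  · refine ⟨1 / 2, show (1 / 2 : ℝ) ∈ Set.Icc (0 : ℝ) 1 by norm_num, fun k => ?_⟩
    simp [RegionalBandits.linearMachine]
  · rcases Nat.eq_zero_or_pos T with rfl | hT
    · refine le_iSup₂_of_le (RegionalBandits.centre M)
        (fun m => show (1 / 2 : ℝ) ∈ Set.Icc (0 : ℝ) 1 by norm_num) ?_
      refine EReal.coe_le_coe_iff.2 ?_
      have h0 : min (√((M : ℝ) * (0 : ℕ)))
          (((0 : ℕ) : ℝ) ^ (1 - RegionalBandits.exponent γ₁ γ₂)) ≤ 0 :=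
        (min_le_left _ _).trans (by simp)
      simpa [RegionalBandits.RegionalBandit.regret] using
        mul_nonpos_of_nonneg_of_nonpos (show 0 ≤ min b d / 64 by positivity) h0
    · obtain ⟨θ, hθ, hreg⟩ := RegionalBandits.exists_hardMachine_regret_ge hb hκ.le hs hsb
        (fun a => min_le_min_left b (hc a).2.2.2.1) hK hsum π hT
      refine le_iSup₂_of_le θ (fun m => ?_) ?_
      · have := abs_le.1 (hθ m)
        exact ⟨by linarith [this.1], by linarith [this.2]⟩
      · refine EReal.coe_le_coe_iff.2 (le_trans ?_ hreg)
        have hT1 : (1 : ℝ) ≤ T := by exact_mod_cast hT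
        have hξ := RegionalBandits.exponent_nonneg (γ₁ := γ₁) (γ₂ := γ₂)
          (fun a => zero_le_one.trans (hc a).2.2.2.2.1.le) (fun a => (hc a).2.2.2.2.2.1.le)
        have hpow : (T : ℝ) ^ (1 - RegionalBandits.exponent γ₁ γ₂) ≤ T := by
          simpa using Real.rpow_le_rpow_of_exponent_le hT1 (sub_le_self 1 hξ)
        gcongr
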